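/- Let $q$ be a prime power, $Q=q^2$, $m\ge 3$, $n=Q^m-1$, and let $\beta$ be a primitive element of $\mathbb{F}_{Q^m}$. For $2\le\delta\le n$ let $\mathcal{C}_\delta\subseteq\mathbb{F}_Q^n$ be the narrow-sense BCH code of length $n$ and designed distance $\delta$, i.e. the cyclic code generated by the least common multiple of the minimal polynomials over $\mathbb{F}_Q$ of $\beta,\beta^2,\dots,\beta^{\delta-1}$, and let $\mathcal{C}_\delta^{\perp H}=\{x\in\mathbb{F}_Q^n:\sum_i x_ic_i^q=0\ \text{for all } c\in\mathcal{C}_\delta\}$ be its Hermitian dual. Let $A=(a_{ij})$ be a nonsingular $2\times2$ matrix over $\mathbb{F}_Q$ and let $$\mathcal{C}'_\delta=[\mathcal{C}_\delta^{\perp H},\mathcal{C}_\delta]A=\{(a_{11}u+a_{21}v,\ a_{12}u+a_{22}v): u\in\mathcal{C}_\delta^{\perp H},\ v\in\mathcal{C}_\delta\}\subseteq\mathbb{F}_Q^{2n}$$ be the matrix-product code. Then $\mathcal{C}'_\delta$ is a linear code of length $2n$ and dimension $n$, and its minimum Hamming distance $d(\mathcal{C}'_\delta)$ satisfies the following, where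 $a$ and $s$ are integers. If $m$ is odd and both entries $a_{11},a_{12}$ of the first row of $A$ are nonzero, then $$d(\mathcal{C}'_\delta)\ge\begin{cases} 2q^m-2s+2, & \text{if } 2\le s\le q-1 \text{ and } sq^m\le\delta\le(s+1)q^m-1,\\ 2q^m-2aq-2s+2, & \text{if } 1\le a\le q-2,\ 0\le s\le q-1 \text{ and } (aq+s)q^m\le\delta\le(aq+s+1)q^m-1,\\ 2q^m-2q^2+2q-2s+2, & \text{if } 0\le s\le q-2 \text{ and } (q^2-q+s)q^m\le\delta\le(q^2-q+s+1)q^m-1,\\ 2q^m-2q^2+4, & \text{if } (q^2-1)q^m\le\delta\le q^{m+2}-q^2+1. \end{cases}$$ If $m$ is even, then $d(\mathcal{C}'_\delta)\ge\delta$ whenever one of the following holds: 1. $2\le a\le q-2$, $0\le s\le q-1$, $q^2\ge aq+s$ and $(aq+s)q^{m-1}\le\delta\le(aq+s+1)q^{m-1}-1$; 2. $0\le s\le q-2$ and $(q^2-q+s)q^{m-1}\le\delta\le(q^2-q+s+1)q^{m-1}-1$; 3. $(q^2-1)q^{m-1}\le\delta\le q^{m+1}-q^2+1$. In each of these cases the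 stated lower bound for $d(\mathcal{C}'_\delta)$ is strictly larger than the square root $\sqrt{2n}$ of the length, except that in case 2 for even $m$ this is asserted only for $q\ne2$. -/

import Mathlib

open Polynomial

noncomputable section

namespace BCHMatrixProduct

/-- The minimum Hamming distance of a linear code `C` of length `N`: the least distance between
two distinct codewords (with the convention `sInf ∅ = 0` for the zero code). -/
def minDist {F : Type*} [Field F] [DecidableEq F] {N : ℕ} (C : Submodule F (Fin N → F)) : ℕ :=
  sInf {d : ℕ | ∃ x ∈ C, ∃ y ∈ C, x ≠ y ∧ hammingDist x y = d}

/-- The class of `c₀ + c₁ x + ⋯ + c_{n-1} x^{n-1}` in `F[x] / ⟨x^n - 1⟩`, as a linear map of the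
vector `(c₀, …, c_{n-1})`. -/
def vecToQuotient (F : Type*) [Field F] (n : ℕ) :
    (Fin n → F) →ₗ[F] F[X] ⧸ Ideal.span {(X ^ n - 1 : F[X])} :=
  (Ideal.Quotient.mkₐ F (Ideal.span {(X ^ n - 1 : F[X])})).toLinearMap ∘ₗ
    ∑ i : Fin n, (monomial (i : ℕ) : F →ₗ[F] F[X]) ∘ₗ LinearMap.proj i

/-- The cyclic code of length `n` generated by the polynomial `g`: the vectors whose class lies
in the ideal of `F[x] / ⟨x^n - 1⟩` generated by the class of `g`. -/
def cyclicCode {F : Type*} [Field F] (n : ℕ) (g : F[X]) : Submodule F (Fin n → F) :=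
  ((Ideal.span {Ideal.Quotient.mk (Ideal.span {(X ^ n - 1 : F[X])}) g}).restrictScalars F).comap
    (vecToQuotient F n)

open Classical in
/-- The (monic) least common multiple of the minimal polynomials over `F` of
`β, β², …, β^(δ - 1)`. -/
def bchGenerator (F : Type*) {K : Type*} [Field F] [Field K] [Algebra F K] (β : K) (δ : ℕ) :
    F[X] :=
  letI : NormalizedGCDMonoid F[X] := UniqueFactorizationMonoid.toNormalizedGCDMonoid F[X]
  (Finset.Icc 1 (δ - 1)).lcm fun i => minpoly F (β ^ i)

/-- The narrow-sense BCH code over `F` of length `n` and designed distance `δ`, with respect to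
the primitive `n`-th root of unity `β`. -/
def bchCode (F : Type*) {K : Type*} [Field F] [Field K] [Algebra F K] (n : ℕ) (β : K) (δ : ℕ) :
    Submodule F (Fin n → F) :=
  cyclicCode n (bchGenerator F β δ)

/-- The Hermitian dual of a code over a field with `q²` elements, with respect to the form
`⟨x, c⟩ = ∑ i, x i * (c i) ^ q`. -/
def hermitianDual {F : Type*} [Field F] (q : ℕ) {n : ℕ} (C : Submodule F (Fin n → F)) :
    Submodule F (Fin n → F) where
  carrier := {x | ∀ c ∈ C, ∑ i, x i * c i ^ q = 0}
  zero_mem' := by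
    intro c _
    simp
  add_mem' := by
    intro x y hx hy c hc
    simp only [Pi.add_apply, add_mul, Finset.sum_add_distrib, hx c hc, hy c hc, add_zero]
  smul_mem' := by
    intro r x hx c hc
    simp only [Pi.smul_apply, smul_eq_mul, mul_assoc, ← Finset.mul_sum, hx c hc, mul_zero]

/-- The matrix-product code `[C₀, …, C_{s-1}] A`, of length `t * n`: the codewords are the
concatenations of the `t` blocks `∑ i, A i j • c i` of length `n`, where `c i ∈ C i`. -/
def matrixProductCode {F : Type*} [Field F] {s t n : ℕ} (C : Fin s → Submodule F (Fin n → F))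
    (A : Matrix (Fin s) (Fin t) F) : Submodule F (Fin (t * n) → F) where
  carrier := {x | ∃ c : Fin s → Fin n → F, (∀ i, c i ∈ C i) ∧
    ∀ k : Fin (t * n), x k = ∑ i, A i k.divNat * c i k.modNat}
  zero_mem' := ⟨0, fun i => (C i).zero_mem, fun k => by simp⟩
  add_mem' := by
    rintro x y ⟨c, hc, hx⟩ ⟨d, hd, hy⟩
    refine ⟨c + d, fun i => (C i).add_mem (hc i) (hd i), fun k => ?_⟩
    simp only [Pi.add_apply, hx k, hy k, mul_add, Finset.sum_add_distrib]
  smul_mem' := by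
    rintro r x ⟨c, hc, hx⟩
    refine ⟨r • c, fun i => (C i).smul_mem r (hc i), fun k => ?_⟩
    simp only [Pi.smul_apply, smul_eq_mul, hx k, Finset.mul_sum]
    exact Finset.sum_congr rfl fun i _ => by ring

end BCHMatrixProduct

end

/-! Put M = q^m, so n = M² - 1. If x lies in the Hermitian dual, then x(β^j) = 0 as soon as n
divides no j q^(2e+1) + i with e < m and 1 ≤ i ≤ δ - 1 (`sum_eq_zero_of_mem_hermitianDual`): trace
vectors built from β^(jq) then lie in the BCH code, and the trace form is nondegenerate. The rest is
arithmetic modulo n.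

For m even the odd exponent 2e+1 is never m, and size alone excludes divisibility. The dual is then
a subcode of the BCH code, so every block of a codeword lies in that code.

For m odd the exponent m occurs (`not_dvd_mul_add_of_sq`). With t = ⌊δ/M⌋ the dual still has the M -
t consecutive zeros β^0, β^1, …, so its distance is at least M - t + 1. The matrix-product bound
min(2d₀, d₁) gives the claim, because d₁ ≥ δ ≥ 2M. -/

namespace BCHMatrixProduct

/-! ### Divisibility by q^(2m) - 1 and size estimates -/

section NumberTheory

/-- Multiply by q^f and use q^(l+f) ≡ 1 mod n. This trades a large exponent for its complement. -/
theorem dvd_mul_pow_add_of_dvd {q n l f i j : ℕ} (hn : n + 1 = q ^ (l + f))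
    (h : n ∣ j * q ^ l + i) : n ∣ i * q ^ f + j := by
  have h1 : n ∣ (j * q ^ l + i) * q ^ f := h.mul_right _
  have h2 : (j * q ^ l + i) * q ^ f = j * n + (i * q ^ f + j) := by
    have : (j * q ^ l + i) * q ^ f = j * q ^ (l + f) + i * q ^ f := by ring
    rw [this, ← hn]
    ring
  rw [h2] at h1
  exact (Nat.dvd_add_right (Dvd.intro_left j rfl)).1 h1

theorem not_dvd_of_even {q m n e i j : ℕ} (hq : 2 ≤ q) (hm : Even m) (he : e < m)
    (hn : n + 1 = q ^ (2 * m)) (hi : 1 ≤ i) (hi' : i + q ^ 2 ≤ q ^ (m + 1)) (hj : 1 ≤ j)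
    (hj' : j + q ^ 2 ≤ q ^ (m + 1)) : ¬ n ∣ j * q ^ (2 * e + 1) + i := by
  have key : ∀ l i j : ℕ, l + 1 ≤ m → 1 ≤ i → i + q ^ 2 ≤ q ^ (m + 1) →
      j + q ^ 2 ≤ q ^ (m + 1) → ¬ n ∣ j * q ^ l + i := by
    intro l i j hl hi hi' hj' h
    have h1 := Nat.le_of_dvd (by omega) h
    have h2 : q ^ l ≤ q ^ (m - 1) := Nat.pow_le_pow_right (by omega) (by omega)
    have h3 : j * q ^ l ≤ j * q ^ (m - 1) := Nat.mul_le_mul_left _ h2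
    have h4 : (j + q ^ 2) * q ^ (m - 1) ≤ q ^ (m + 1) * q ^ (m - 1) := Nat.mul_le_mul_right _ hj'
    have h5 : q ^ (m + 1) * q ^ (m - 1) = q ^ (2 * m) := by
      rw [← pow_add]; congr 1; omega
    have h6 : q ^ 2 * q ^ (m - 1) = q ^ (m + 1) := by
      rw [← pow_add]; congr 1; omega
    have h7 : 2 ^ 2 ≤ q ^ 2 := Nat.pow_le_pow_left hq 2
    rw [add_mul, h5, h6] at h4
    omega
  obtain ⟨k, rfl⟩ := hm
  intro h
  rcases Nat.lt_or_ge (2 * e + 1) (k + k) with hl | hl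
  · exact key _ _ _ hl hi hi' hj' h
  -- The exponent exceeds m, so it is replaced by its complement to 2m, with i and j swapped.
  · refine key (2 * (k + k) - (2 * e + 1)) j i (by omega) hj hj' hi'
      (dvd_mul_pow_add_of_dvd (l := 2 * e + 1) ?_ h)
    rw [hn]; congr 1; omega

/-- If iM + j = kn, then M divides j + k, which forces k ≥ M - j ≥ t + 1; but i is too small for so
large a quotient. -/
theorem not_dvd_mul_add_of_sq {M n t i j : ℕ} (hn : n + 1 = M * M) (hi : 1 ≤ i)
    (hi' : i + 2 ≤ (t + 1) * M) (hj : j + t + 1 ≤ M) : ¬ n ∣ i * M + j := by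
  rintro ⟨k, hk⟩
  have h1 : i * M + (j + k) = k * M * M := by
    rw [mul_assoc, ← hn, mul_add, mul_comm k n, ← hk]
    ring
  have hiM : 1 * M ≤ i * M := Nat.mul_le_mul_right _ hi
  have hk0 : 1 ≤ k := by
    rcases Nat.eq_zero_or_pos k with rfl | h
    · omega
    · exact h
  have hdvd : M ∣ j + k :=
    (Nat.dvd_add_right (Dvd.intro_left i rfl)).1 (h1 ▸ Dvd.intro_left (k * M) rfl)
  have hle := Nat.le_of_dvd (by omega) hdvd
  have hkt : t + 1 ≤ k := by omega
  obtain ⟨d, rfl⟩ := Nat.exists_eq_add_of_le hkt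
  have h2 : (i + 2) * M ≤ (t + 1) * M * M := Nat.mul_le_mul_right _ hi'
  have h3 : d ≤ d * M * M := by
    rw [mul_assoc]
    exact Nat.le_mul_of_pos_right _ (by omega)
  have h4 : (t + 1 + d) * M * M = (t + 1) * M * M + d * M * M := by ring
  rw [h4] at h1
  rw [add_mul] at h2
  omega

theorem not_dvd_of_odd {q m n e i j t : ℕ} (hq : 2 ≤ q) (hm3 : 3 ≤ m) (hm : Odd m) (he : e < m)
    (hn : n + 1 = q ^ (2 * m)) (ht : 1 ≤ t) (hi : 1 ≤ i)
    (hi' : i + 2 ≤ (t + 1) * q ^ m) (hi'' : i + q ^ 2 ≤ q ^ (m + 2)) (hj : j + t + 1 ≤ q ^ m) :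
    ¬ n ∣ j * q ^ (2 * e + 1) + i := by
  intro h
  obtain ⟨k, rfl⟩ := hm
  have hflip : ∀ f, 2 * e + 1 + f = 2 * (2 * k + 1) → n ∣ i * q ^ f + j := by
    intro f hf
    refine dvd_mul_pow_add_of_dvd (l := 2 * e + 1) ?_ h
    rw [hn, hf]
  -- r = m - 2: an odd exponent other than m is at distance at least 2 from m.
  obtain ⟨r, hr⟩ : ∃ r, 2 * k + 1 = r + 2 := ⟨2 * k - 1, by omega⟩
  have hP : 2 ≤ q ^ r := by
    calc 2 ≤ q := hq
      _ = q ^ 1 := (pow_one q).symm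
      _ ≤ q ^ r := Nat.pow_le_pow_right (by omega) (by omega)
  have hM : q ^ (2 * k + 1) = q ^ r * q ^ 2 := by rw [hr, pow_add]
  have hM2 : q ^ (2 * k + 1 + 2) = q ^ r * q ^ 4 := by rw [hr, add_assoc, pow_add]
  have hN : q ^ (2 * (2 * k + 1)) = q ^ r * q ^ r * q ^ 4 := by rw [hr]; ring
  have hq2 : 2 ^ 2 ≤ q ^ 2 := Nat.pow_le_pow_left hq 2
  rcases lt_trichotomy e k with hek | rfl | hek
  · have h1 := Nat.le_of_dvd (by omega) h
    have h2 : q ^ (2 * e + 1) ≤ q ^ r := Nat.pow_le_pow_right (by omega) (by omega)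
    have h3 : j * q ^ (2 * e + 1) ≤ (q ^ r * q ^ 2) * q ^ r :=
      Nat.mul_le_mul (by omega) h2
    have h4 : (q ^ r * q ^ 2) * q ^ r * 4 ≤ (q ^ r * q ^ 2) * q ^ r * q ^ 2 :=
      Nat.mul_le_mul_left _ hq2
    have h5 : (q ^ r * q ^ 2) * q ^ r * q ^ 2 = q ^ r * q ^ r * q ^ 4 := by ring
    have h6 : q ^ r * q ^ 4 * 2 ≤ q ^ r * q ^ 4 * q ^ r := Nat.mul_le_mul_left _ hP
    have h7 : q ^ r * q ^ 4 * q ^ r = q ^ r * q ^ r * q ^ 4 := by ring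
    omega
  · refine not_dvd_mul_add_of_sq (t := t) ?_ hi hi' hj (hflip (2 * e + 1) (by omega))
    rw [hn]; ring
  · have h0 := hflip (2 * (2 * k + 1) - (2 * e + 1)) (by omega)
    have hpos : 0 < q ^ (2 * (2 * k + 1) - (2 * e + 1)) := Nat.pow_pos (by omega)
    have h1 := Nat.le_of_dvd (Nat.add_pos_left (Nat.mul_pos hi hpos) _) h0
    have h2 : q ^ (2 * (2 * k + 1) - (2 * e + 1)) ≤ q ^ r :=
      Nat.pow_le_pow_right (by omega) (by omega)
    have h3 := Nat.mul_le_mul_left i h2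
    have h4 := Nat.mul_le_mul_right (q ^ r) hi''
    rw [add_mul, hM2] at h4
    have h5 : q ^ r * q ^ 4 * q ^ r = q ^ r * q ^ r * q ^ 4 := by ring
    have h6 : q ^ 2 * q ^ r = q ^ r * q ^ 2 := mul_comm _ _
    omega

/-- Here 1.45 is a rational slightly above √2. -/
theorem sqrt_two_mul_lt {M n : ℕ} {y : ℝ} (hn : n + 1 = M * M) (hM : 0 < M)
    (hy : 1.45 * (M : ℝ) ≤ y) : √(2 * n : ℝ) < y := by
  have hM' : (0 : ℝ) < M := by exact_mod_cast hM
  have hn' : (n : ℝ) + 1 = M * M := by exact_mod_cast hn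
  rw [Real.sqrt_lt' (by linarith)]
  nlinarith

/-- Equivalent to 1.45 q^m ≤ 2q^m - 2(q² - 1) + 2, the worst case t = q² - 1 for odd m. -/
theorem forty_mul_sq_le {q m : ℕ} (hq : 2 ≤ q) (hm : 3 ≤ m) : 40 * q ^ 2 ≤ 11 * q ^ m + 80 := by
  rcases Nat.eq_or_lt_of_le hm with rfl | hm
  · rcases Nat.lt_or_ge q 4 with h | h
    · interval_cases q <;> norm_num
    · have : q ^ 2 * 4 ≤ q ^ 2 * q := Nat.mul_le_mul_left _ h
      have h3 : q ^ 3 = q ^ 2 * q := by ring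
      omega
  · have h1 : q ^ 2 * 2 ^ 2 ≤ q ^ 2 * q ^ 2 := Nat.mul_le_mul_left _ (Nat.pow_le_pow_left hq 2)
    have h2 : q ^ 2 * q ^ 2 ≤ q ^ m := by
      rw [← pow_add]
      exact Nat.pow_le_pow_right (by omega) (by omega)
    omega

end NumberTheory

/-! ### Hamming weight and the BCH bound -/

section Hamming

variable {F : Type*} [Field F] [DecidableEq F]

theorem le_minDist {N d : ℕ} {C : Submodule F (Fin N → F)} (hC : C ≠ ⊥)
    (h : ∀ x ∈ C, x ≠ 0 → d ≤ hammingNorm x) : d ≤ minDist C := by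
  obtain ⟨x, hx, hx0⟩ := C.exists_mem_ne_zero_of_ne_bot hC
  refine le_csInf ⟨_, x, hx, 0, C.zero_mem, hx0, rfl⟩ ?_
  rintro _ ⟨x, hx, y, hy, hxy, rfl⟩
  rw [hammingDist_eq_hammingNorm]
  exact h _ (C.add_mem (C.neg_mem hx) hy) fun h0 => hxy (neg_add_eq_zero.1 h0)

theorem hammingNorm_two_mul {n : ℕ} (x : Fin (2 * n) → F) :
    hammingNorm x = hammingNorm (fun k => x (finProdFinEquiv (0, k))) +
      hammingNorm (fun k => x (finProdFinEquiv (1, k))) := by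
  simp only [hammingNorm, Finset.card_filter]
  rw [← Equiv.sum_comp finProdFinEquiv, Fintype.sum_prod_type, Fin.sum_univ_two]

/-- The BCH bound. -/
theorem lt_hammingNorm_of_sum_mul_pow_eq_zero {K : Type*} [Field K] [Algebra F K] {n w : ℕ}
    {β : K} (hβ : IsPrimitiveRoot β n) {x : Fin n → F} (hx : x ≠ 0) (j₀ : ℕ)
    (h : ∀ j < w, ∑ k : Fin n, algebraMap F K (x k) * β ^ ((j₀ + j) * (k : ℕ)) = 0) :
    w < hammingNorm x := by
  by_contra! hw
  set S : Finset (Fin n) := Finset.univ.filter fun k => x k ≠ 0 with hS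
  have hcard : S.card ≤ w := hw
  obtain ⟨k₀, hk₀⟩ := Function.ne_iff.1 hx
  have hn : n ≠ 0 := by
    rintro rfl
    exact k₀.elim0
  let g : Fin S.card → Fin n := fun a => (S.equivFin.symm a : Fin n)
  have hg : Function.Injective fun a => β ^ (g a : ℕ) := by
    intro a b hab
    have := hβ.pow_inj (g a).2 (g b).2 hab
    exact S.equivFin.symm.injective (Subtype.ext (Fin.ext this))
  -- A Vandermonde system on the support, with distinct nodes β^k; the offset j₀ is absorbed into
  -- the unknowns.
  have hv := Matrix.eq_zero_of_forall_pow_sum_mul_pow_eq_zero (v := fun a =>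
    algebraMap F K (x (g a)) * β ^ (j₀ * (g a : ℕ))) hg (by
      intro i
      rw [← h i (lt_of_lt_of_le i.2 hcard)]
      have h1 : ∑ k : Fin n, algebraMap F K (x k) * β ^ ((j₀ + i) * (k : ℕ)) =
          ∑ k ∈ S, algebraMap F K (x k) * β ^ ((j₀ + i) * (k : ℕ)) := by
        refine (Finset.sum_subset (Finset.subset_univ S) fun k _ hk => ?_).symm
        have : x k = 0 := by simpa [hS] using hk
        simp [this]
      rw [h1, ← Finset.sum_coe_sort S, ← Equiv.sum_comp S.equivFin.symm]
      refine Finset.sum_congr rfl fun a _ => ?_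
      simp only [g]
      ring)
  have hk₀S : k₀ ∈ S := by simpa [hS] using hk₀
  have h2 := congrFun hv (S.equivFin ⟨k₀, hk₀S⟩)
  have hgk : g (S.equivFin ⟨k₀, hk₀S⟩) = k₀ := by simp [g]
  simp only [hgk, Pi.zero_apply, mul_eq_zero, map_eq_zero] at h2
  rcases h2 with h2 | h2
  · exact hk₀ h2
  · exact hβ.ne_zero hn (eq_zero_of_pow_eq_zero h2)

end Hamming

/-! ### BCH codes by their zeros, and the Hermitian dual -/

theorem bchGenerator_dvd_iff {F K : Type*} [Field F] [Field K] [Algebra F K] {β : K} {δ : ℕ}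
    {p : F[X]} : bchGenerator F β δ ∣ p ↔ ∀ i ∈ Finset.Icc 1 (δ - 1), aeval (β ^ i) p = 0 := by
  simp only [bchGenerator, Finset.lcm_dvd_iff, minpoly.dvd_iff]

theorem mem_bchCode_iff {F K : Type*} [Field F] [Field K] [Algebra F K] {n : ℕ} {β : K}
    (hβ : β ^ n = 1) {δ : ℕ} {c : Fin n → F} :
    c ∈ bchCode F n β δ ↔ ∀ i ∈ Finset.Icc 1 (δ - 1),
      ∑ k : Fin n, algebraMap F K (c k) * β ^ (i * (k : ℕ)) = 0 := by
  classical
  set p : F[X] := ∑ k : Fin n, monomial (k : ℕ) (c k) with hp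
  have hvec : vecToQuotient F n c = Ideal.Quotient.mk (Ideal.span {(X ^ n - 1 : F[X])}) p := by
    simp [vecToQuotient, hp]
  have heval : ∀ i : ℕ, aeval (β ^ i) p =
      ∑ k : Fin n, algebraMap F K (c k) * β ^ (i * (k : ℕ)) := by
    intro i
    simp [hp, aeval_monomial, pow_mul]
  have hg : bchGenerator F β δ ∣ X ^ n - 1 := by
    refine bchGenerator_dvd_iff.2 fun i _ => ?_
    simp [← pow_mul, mul_comm i n, pow_mul β n i, hβ]
  have hmem : c ∈ bchCode F n β δ ↔ bchGenerator F β δ ∣ p := by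
    change vecToQuotient F n c ∈ Ideal.span _ ↔ _
    rw [hvec, Ideal.mem_span_singleton]
    constructor
    · rintro ⟨r, hr⟩
      obtain ⟨r, rfl⟩ := Ideal.Quotient.mk_surjective r
      rw [← map_mul, Ideal.Quotient.eq, Ideal.mem_span_singleton] at hr
      have := dvd_add (hg.trans hr) (dvd_mul_right (bchGenerator F β δ) r)
      rwa [sub_add_cancel] at this
    · exact fun h => map_dvd _ h
  rw [hmem]
  simp only [← heval, bchGenerator_dvd_iff]

theorem exists_charP_of_card {F : Type*} [Field F] [Fintype F] {q : ℕ} (hq : IsPrimePow q)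
    (hF : Fintype.card F = q ^ 2) : ∃ p k : ℕ, p.Prime ∧ CharP F p ∧ q = p ^ k := by
  obtain ⟨p, k, hp, -, rfl⟩ := hq
  obtain ⟨r, hr⟩ := CharP.exists F
  obtain ⟨a, hr', ha⟩ := FiniteField.card F r
  rw [hF] at ha
  have h1 : r ∣ (p ^ k) ^ 2 := ha ▸ dvd_pow_self r a.ne_zero
  have h2 : r = p := (Nat.prime_dvd_prime_iff_eq hr' hp.nat_prime).1
    (hr'.dvd_of_dvd_pow (hr'.dvd_of_dvd_pow h1))
  exact ⟨p, k, hp.nat_prime, h2 ▸ hr, rfl⟩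

theorem sum_pow_eq_of_card {F R ι : Type*} [Field F] [Fintype F] [CommRing R] [Algebra F R]
    [Nontrivial R] {q : ℕ} (hq : IsPrimePow q) (hF : Fintype.card F = q ^ 2) (s : Finset ι)
    (f : ι → R) : (∑ i ∈ s, f i) ^ q = ∑ i ∈ s, f i ^ q := by
  obtain ⟨p, k, hp, hc, rfl⟩ := exists_charP_of_card hq hF
  have : Fact p.Prime := ⟨hp⟩
  have : CharP R p := charP_of_injective_algebraMap (algebraMap F R).injective p
  exact sum_pow_char_pow _ _ _ _

theorem pow_pow_eq_self {F : Type*} [Field F] [Fintype F] {q : ℕ} (hF : Fintype.card F = q ^ 2)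
    (x : F) : (x ^ q) ^ q = x := by
  rw [← pow_mul, ← pow_two, ← hF, FiniteField.pow_card]

theorem mem_hermitianDual_iff {F : Type*} [Field F] [Fintype F] {q n : ℕ} (hq : IsPrimePow q)
    (hF : Fintype.card F = q ^ 2) {C : Submodule F (Fin n → F)} {x : Fin n → F} :
    x ∈ hermitianDual q C ↔ ∀ c ∈ C, ∑ i, x i ^ q * c i = 0 := by
  refine forall₂_congr fun c _ => ?_
  rw [← pow_eq_zero_iff (n := q) hq.pos.ne', sum_pow_eq_of_card hq hF]
  simp only [mul_pow, pow_pow_eq_self hF]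

/-- The coordinatewise q-th power maps the Hermitian dual bijectively to the Euclidean one. It is
only semilinear, so cardinalities are compared. -/
theorem finrank_hermitianDual {F : Type*} [Field F] [Fintype F] {q n : ℕ} (hq : IsPrimePow q)
    (hF : Fintype.card F = q ^ 2) (C : Submodule F (Fin n → F)) :
    Module.finrank F (hermitianDual q C) + Module.finrank F C = n := by
  let D : Submodule F (Fin n → F) :=
    C.dualAnnihilator.comap (dotProductEquiv F (Fin n)).toLinearMap
  have hD : ∀ x, x ∈ D ↔ ∀ c ∈ C, ∑ i, x i * c i = 0 := by
    intro x
    simp [D, Submodule.mem_dualAnnihilator, dotProduct]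
  have e : hermitianDual q C ≃ D :=
    { toFun := fun x => ⟨fun i => x.1 i ^ q, (hD _).2 ((mem_hermitianDual_iff hq hF).1 x.2)⟩
      invFun := fun y => ⟨fun i => y.1 i ^ q, (mem_hermitianDual_iff hq hF).2 (by
        simpa only [pow_pow_eq_self hF] using (hD _).1 y.2)⟩
      left_inv := fun x => Subtype.ext (funext fun i => pow_pow_eq_self hF _)
      right_inv := fun y => Subtype.ext (funext fun i => pow_pow_eq_self hF _) }
  have hcard : Module.finrank F (hermitianDual q C) = Module.finrank F D := by
    have h1 := Nat.card_congr e
    rw [Module.natCard_eq_pow_finrank (K := F) (V := hermitianDual q C),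
      Module.natCard_eq_pow_finrank (K := F) (V := D)] at h1
    exact Nat.pow_right_injective (Finite.one_lt_card (α := F)) h1
  have hfin : Module.finrank F D = Module.finrank F C.dualAnnihilator :=
    ((dotProductEquiv F (Fin n)).ofSubmodule' C.dualAnnihilator).finrank_eq
  have h2 := Subspace.finrank_add_finrank_dualAnnihilator_eq C
  rw [Module.finrank_fin_fun] at h2
  omega

theorem sum_pow_mul_eq_zero {K : Type*} [Field K] {n : ℕ} {β : K} (hβ : IsPrimitiveRoot β n)
    {r : ℕ} (hr : ¬ n ∣ r) : ∑ k : Fin n, β ^ (r * (k : ℕ)) = 0 := by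
  have h1 : β ^ r ≠ 1 := fun h => hr (hβ.dvd_of_pow_eq_one r h)
  have h2 := geom_sum_mul (β ^ r) n
  rw [← pow_mul, mul_comm r n, pow_mul, hβ.pow_eq_one, one_pow, sub_self] at h2
  have h3 := (mul_eq_zero.1 h2).resolve_right (sub_ne_zero.2 h1)
  rw [← Fin.sum_univ_eq_sum_range (fun i => (β ^ r) ^ i)] at h3
  simpa only [pow_mul] using h3

theorem le_hammingNorm_of_mem_bchCode {F K : Type*} [Field F] [DecidableEq F] [Field K]
    [Algebra F K] {n δ : ℕ} {β : K} (hβ : IsPrimitiveRoot β n)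
    {x : Fin n → F} (hx : x ∈ bchCode F n β δ) (hx0 : x ≠ 0) : δ ≤ hammingNorm x := by
  rw [mem_bchCode_iff hβ.pow_eq_one] at hx
  have := lt_hammingNorm_of_sum_mul_pow_eq_zero (w := δ - 1) hβ hx0 1 fun j hj =>
    hx (1 + j) (Finset.mem_Icc.2 (by omega))
  omega

/-! ### Zeros of the Hermitian dual via traces -/

section Trace

variable {F K : Type*} [Field F] [Fintype F] [Field K] [Fintype K] [Algebra F K] {q m n δ : ℕ}
  {β : K}

/-- Expanding the trace into conjugates turns each parity check into geometric sums of n-th roots of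
unity other than 1. -/
theorem trace_mem_bchCode (hβ : IsPrimitiveRoot β n) {r : ℕ}
    (hr : ∀ e < Module.finrank F K, ∀ i ∈ Finset.Icc 1 (δ - 1),
      ¬ n ∣ r * Fintype.card F ^ e + i) (a : K) :
    (fun k : Fin n => Algebra.trace F K (a * β ^ (r * (k : ℕ)))) ∈ bchCode F n β δ := by
  rw [mem_bchCode_iff hβ.pow_eq_one]
  intro i hi
  simp only [FiniteField.algebraMap_trace_eq_sum_pow, Finset.sum_mul]
  rw [Finset.sum_comm]
  refine Finset.sum_eq_zero fun e he => ?_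
  have h := sum_pow_mul_eq_zero hβ (hr e (Finset.mem_range.1 he) i hi)
  rw [← mul_zero (a ^ Nat.card F ^ e), ← h, Finset.mul_sum]
  refine Finset.sum_congr rfl fun k _ => ?_
  rw [Nat.card_eq_fintype_card]
  ring

theorem sum_eq_zero_of_mem_hermitianDual (hq : IsPrimePow q) (hF : Fintype.card F = q ^ 2)
    (hK : Fintype.card K = (q ^ 2) ^ m) (hβ : IsPrimitiveRoot β n) {x : Fin n → F}
    (hx : x ∈ hermitianDual q (bchCode F n β δ)) {j : ℕ}
    (hj : ∀ e < m, ∀ i, 1 ≤ i → i ≤ δ - 1 → ¬ n ∣ j * q ^ (2 * e + 1) + i) :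
    ∑ k : Fin n, algebraMap F K (x k) * β ^ (j * (k : ℕ)) = 0 := by
  have hfr : Module.finrank F K = m := by
    have h := Module.card_eq_pow_finrank (K := F) (V := K)
    rw [hK, hF] at h
    exact (Nat.pow_right_injective (hF ▸ Fintype.one_lt_card (α := F)) h).symm
  rw [← pow_eq_zero_iff (n := q) hq.pos.ne', sum_pow_eq_of_card (F := F) hq hF]
  refine (traceForm_nondegenerate F K).1 _ fun a => ?_
  rw [Algebra.traceForm_apply, Finset.sum_mul, map_sum]
  -- With r = jq, the conjugates r (q²)^e are the j q^(2e+1).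
  have hmem := trace_mem_bchCode (F := F) (δ := δ) hβ (r := j * q) (fun e he i hi => by
    rw [Finset.mem_Icc] at hi
    have h := hj e (hfr ▸ he) i hi.1 hi.2
    rwa [pow_succ', ← mul_assoc, pow_mul, ← hF] at h) a
  rw [← (mem_hermitianDual_iff hq hF).1 hx _ hmem]
  refine Finset.sum_congr rfl fun k _ => ?_
  rw [← smul_eq_mul (x k ^ q), ← map_smul]
  congr 1
  rw [Algebra.smul_def, map_pow]
  ring

theorem hermitianDual_le_of_even (hq : IsPrimePow q) (hF : Fintype.card F = q ^ 2)
    (hK : Fintype.card K = (q ^ 2) ^ m) (hβ : IsPrimitiveRoot β n) (hm : Even m)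
    (hn : n + 1 = q ^ (2 * m)) (hδ : δ - 1 + q ^ 2 ≤ q ^ (m + 1)) :
    hermitianDual q (bchCode F n β δ) ≤ bchCode F n β δ := by
  intro x hx
  rw [mem_bchCode_iff hβ.pow_eq_one]
  intro j hj
  rw [Finset.mem_Icc] at hj
  refine sum_eq_zero_of_mem_hermitianDual hq hF hK hβ hx fun e he i hi hi' => ?_
  exact not_dvd_of_even hq.two_le hm he hn hi (by omega) hj.1 (by omega)

theorem le_hammingNorm_of_mem_hermitianDual [DecidableEq F] (hq : IsPrimePow q)
    (hF : Fintype.card F = q ^ 2) (hK : Fintype.card K = (q ^ 2) ^ m)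
    (hβ : IsPrimitiveRoot β n) (hm3 : 3 ≤ m) (hm : Odd m) (hn : n + 1 = q ^ (2 * m)) {t : ℕ}
    (ht : 1 ≤ t) (hδ : δ + 1 ≤ (t + 1) * q ^ m) (hδ' : δ - 1 + q ^ 2 ≤ q ^ (m + 2))
    {x : Fin n → F} (hx : x ∈ hermitianDual q (bchCode F n β δ)) (hx0 : x ≠ 0) :
    q ^ m + 1 ≤ hammingNorm x + t := by
  have := lt_hammingNorm_of_sum_mul_pow_eq_zero (w := q ^ m - t) hβ hx0 0 fun j hj =>
    sum_eq_zero_of_mem_hermitianDual hq hF hK hβ hx fun e he i hi hi' =>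
      not_dvd_of_odd hq.two_le hm3 hm he hn ht hi (by omega) (by omega) (by omega)
  omega

end Trace

/-! ### Dimension and distance of matrix-product codes -/

section MatrixProduct

variable {F : Type*} [Field F] {n : ℕ}

theorem finrank_matrixProductCode {s t : ℕ} (C : Fin s → Submodule F (Fin n → F))
    (A : Matrix (Fin s) (Fin t) F) (hA : LinearIndependent F A.row) :
    Module.finrank F (matrixProductCode C A) = ∑ i, Module.finrank F (C i) := by
  let f : ((i : Fin s) → C i) →ₗ[F] (Fin (t * n) → F) :=
    { toFun := fun c k => ∑ i, A i k.divNat * (c i : Fin n → F) k.modNat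
      map_add' := fun c d => by
        ext k
        simp [mul_add, Finset.sum_add_distrib]
      map_smul' := fun r c => by
        ext k
        simp only [Pi.smul_apply, Submodule.coe_smul, smul_eq_mul, Finset.mul_sum,
          RingHom.id_apply]
        exact Finset.sum_congr rfl fun i _ => by ring }
  have hf : Function.Injective f := by
    rw [injective_iff_map_eq_zero]
    intro c hc
    ext i k
    refine Fintype.linearIndependent_iff.1 hA (fun i => (c i : Fin n → F) k) ?_ i
    ext j
    have h := congrFun hc (finProdFinEquiv (j, k))
    have h1 : (finProdFinEquiv (j, k)).divNat = j :=
      congrArg Prod.fst (finProdFinEquiv.symm_apply_apply (j, k))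
    have h2 : (finProdFinEquiv (j, k)).modNat = k :=
      congrArg Prod.snd (finProdFinEquiv.symm_apply_apply (j, k))
    simp only [f, LinearMap.coe_mk, AddHom.coe_mk, h1, h2, Pi.zero_apply] at h
    simpa [Finset.sum_apply, mul_comm, Matrix.row] using h
  have hrange : matrixProductCode C A = LinearMap.range f := by
    ext x
    constructor
    · rintro ⟨c, hc, hx⟩
      exact ⟨fun i => ⟨c i, hc i⟩, funext fun k => (hx k).symm⟩
    · rintro ⟨c, rfl⟩
      exact ⟨fun i => c i, fun i => (c i).2, fun k => rfl⟩
  rw [hrange, LinearMap.finrank_range_of_inj hf, Module.finrank_pi_fintype]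

theorem exists_of_mem_matrixProductCode_two {C₀ C₁ : Submodule F (Fin n → F)}
    {A : Matrix (Fin 2) (Fin 2) F} {x : Fin (2 * n) → F}
    (hx : x ∈ matrixProductCode ![C₀, C₁] A) : ∃ u ∈ C₀, ∃ v ∈ C₁, ∀ j,
      (fun k => x (finProdFinEquiv (j, k))) = A 0 j • u + A 1 j • v := by
  obtain ⟨c, hc, hx⟩ := hx
  refine ⟨c 0, hc 0, c 1, hc 1, fun j => ?_⟩
  ext k
  have h1 : (finProdFinEquiv (j, k)).divNat = j :=
    congrArg Prod.fst (finProdFinEquiv.symm_apply_apply (j, k))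
  have h2 : (finProdFinEquiv (j, k)).modNat = k :=
    congrArg Prod.snd (finProdFinEquiv.symm_apply_apply (j, k))
  simp [hx, h1, h2, Fin.sum_univ_two]

variable [DecidableEq F]

theorem hammingNorm_smul_le (a : F) (x : Fin n → F) : hammingNorm (a • x) ≤ hammingNorm x :=
  hammingNorm_smul_le_hammingNorm

theorem hammingNorm_add_le (x y : Fin n → F) :
    hammingNorm (x + y) ≤ hammingNorm x + hammingNorm y := by
  have h := hammingDist_triangle (-x) 0 y
  simpa [hammingDist_eq_hammingNorm, hammingDist_zero_left, hammingDist_zero_right] using h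

theorem le_hammingNorm_of_le {C₀ C₁ : Submodule F (Fin n → F)} (h01 : C₀ ≤ C₁)
    {A : Matrix (Fin 2) (Fin 2) F} {d : ℕ} (hC₁ : ∀ v ∈ C₁, v ≠ 0 → d ≤ hammingNorm v)
    {x : Fin (2 * n) → F} (hx : x ∈ matrixProductCode ![C₀, C₁] A) (hx0 : x ≠ 0) :
    d ≤ hammingNorm x := by
  obtain ⟨u, hu, v, hv, h⟩ := exists_of_mem_matrixProductCode_two hx
  have hmem : ∀ j, A 0 j • u + A 1 j • v ∈ C₁ := fun j =>
    C₁.add_mem (C₁.smul_mem _ (h01 hu)) (C₁.smul_mem _ hv)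
  rw [hammingNorm_two_mul, h 0, h 1]
  by_cases h0 : A 0 0 • u + A 1 0 • v = 0
  · by_cases h1 : A 0 1 • u + A 1 1 • v = 0
    · refine absurd ?_ (hammingNorm_ne_zero_iff.2 hx0)
      rw [hammingNorm_two_mul, h 0, h 1, h0, h1, hammingNorm_zero]
    · exact (hC₁ _ (hmem 1) h1).trans (Nat.le_add_left _ _)
  · exact (hC₁ _ (hmem 0) h0).trans (Nat.le_add_right _ _)

/-- If v = 0, both blocks are nonzero multiples of u. Otherwise eliminating u between the blocks
leaves det A • v, whose weight is at most the sum of the block weights. -/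
theorem min_le_hammingNorm {C₀ C₁ : Submodule F (Fin n → F)} {A : Matrix (Fin 2) (Fin 2) F}
    (hA : A.det ≠ 0) (h0 : A 0 0 ≠ 0) (h1 : A 0 1 ≠ 0) {d₀ d₁ : ℕ}
    (hC₀ : ∀ u ∈ C₀, u ≠ 0 → d₀ ≤ hammingNorm u) (hC₁ : ∀ v ∈ C₁, v ≠ 0 → d₁ ≤ hammingNorm v)
    {x : Fin (2 * n) → F} (hx : x ∈ matrixProductCode ![C₀, C₁] A) (hx0 : x ≠ 0) :
    min (2 * d₀) d₁ ≤ hammingNorm x := by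
  obtain ⟨u, hu, v, hv, h⟩ := exists_of_mem_matrixProductCode_two hx
  by_cases hv0 : v = 0
  · subst hv0
    have hu0 : u ≠ 0 := by
      rintro rfl
      refine hammingNorm_ne_zero_iff.2 hx0 ?_
      rw [hammingNorm_two_mul, h 0, h 1]
      simp
    have h2 : ∀ j, A 0 j ≠ 0 →
        d₀ ≤ hammingNorm (fun k => x (finProdFinEquiv (j, k))) := by
      intro j hj
      rw [h j, smul_zero, add_zero]
      exact hC₀ _ (C₀.smul_mem _ hu) (smul_ne_zero hj hu0)
    have h3 := h2 0 h0
    have h4 := h2 1 h1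
    rw [hammingNorm_two_mul]
    omega
  · refine (min_le_right _ _).trans ?_
    have hdet : A 0 0 • (A 0 1 • u + A 1 1 • v) + (-A 0 1) • (A 0 0 • u + A 1 0 • v) =
        A.det • v := by
      rw [Matrix.det_fin_two]
      module
    refine (hC₁ (A.det • v) (C₁.smul_mem _ hv) (smul_ne_zero hA hv0)).trans ?_
    rw [hammingNorm_two_mul, h 0, h 1, ← hdet, add_comm (hammingNorm (A 0 0 • u + A 1 0 • v))]
    exact (hammingNorm_add_le _ _).trans
      (Nat.add_le_add (hammingNorm_smul_le _ _) (hammingNorm_smul_le _ _))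

end MatrixProduct

end BCHMatrixProduct

/-! ### The main theorem -/

open BCHMatrixProduct in
theorem mainTheorem7 {F K : Type*} [Field F] [Fintype F] [DecidableEq F]
    [Field K] [Fintype K] [Algebra F K]
    (q m n δ : ℕ) (hq : IsPrimePow q) (hm : 3 ≤ m) (hn : n = (q ^ 2) ^ m - 1)
    (hF : Fintype.card F = q ^ 2) (hK : Fintype.card K = (q ^ 2) ^ m)
    (β : K) (hβ : IsPrimitiveRoot β n) (hδ : 2 ≤ δ) (hδn : δ ≤ n)
    (A : Matrix (Fin 2) (Fin 2) F) (hA : A.det ≠ 0)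
    (C' : Submodule F (Fin (2 * n) → F))
    (hC' : C' = matrixProductCode ![hermitianDual q (bchCode F n β δ), bchCode F n β δ] A) :
    Module.finrank F C' = n ∧
    -- `m` odd, no zero in the first row of `A`
    (Odd m → A 0 0 ≠ 0 → A 0 1 ≠ 0 →
      (∀ s : ℕ, 2 ≤ s → s ≤ q - 1 → s * q ^ m ≤ δ → δ ≤ (s + 1) * q ^ m - 1 →
        (2 * q ^ m - 2 * s + 2 : ℝ) ≤ minDist C' ∧
        √(2 * n : ℝ) < 2 * q ^ m - 2 * s + 2) ∧
      (∀ a s : ℕ, 1 ≤ a → a ≤ q - 2 → s ≤ q - 1 →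
        (a * q + s) * q ^ m ≤ δ → δ ≤ (a * q + s + 1) * q ^ m - 1 →
        (2 * q ^ m - 2 * a * q - 2 * s + 2 : ℝ) ≤ minDist C' ∧
        √(2 * n : ℝ) < 2 * q ^ m - 2 * a * q - 2 * s + 2) ∧
      (∀ s : ℕ, s ≤ q - 2 →
        (q ^ 2 - q + s) * q ^ m ≤ δ → δ ≤ (q ^ 2 - q + s + 1) * q ^ m - 1 →
        (2 * q ^ m - 2 * q ^ 2 + 2 * q - 2 * s + 2 : ℝ) ≤ minDist C' ∧
        √(2 * n : ℝ) < 2 * q ^ m - 2 * q ^ 2 + 2 * q - 2 * s + 2) ∧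
      ((q ^ 2 - 1) * q ^ m ≤ δ → δ ≤ q ^ (m + 2) - q ^ 2 + 1 →
        (2 * q ^ m - 2 * q ^ 2 + 4 : ℝ) ≤ minDist C' ∧
        √(2 * n : ℝ) < 2 * q ^ m - 2 * q ^ 2 + 4)) ∧
    -- `m` even
    (Even m →
      (∀ a s : ℕ, 2 ≤ a → a ≤ q - 2 → s ≤ q - 1 → a * q + s ≤ q ^ 2 →
        (a * q + s) * q ^ (m - 1) ≤ δ → δ ≤ (a * q + s + 1) * q ^ (m - 1) - 1 →
        δ ≤ minDist C' ∧ √(2 * n : ℝ) < δ) ∧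
      (∀ s : ℕ, s ≤ q - 2 →
        (q ^ 2 - q + s) * q ^ (m - 1) ≤ δ → δ ≤ (q ^ 2 - q + s + 1) * q ^ (m - 1) - 1 →
        δ ≤ minDist C' ∧ (q ≠ 2 → √(2 * n : ℝ) < δ)) ∧
      ((q ^ 2 - 1) * q ^ (m - 1) ≤ δ → δ ≤ q ^ (m + 1) - q ^ 2 + 1 →
        δ ≤ minDist C' ∧ √(2 * n : ℝ) < δ)) := by
  have hq2 : 2 ≤ q := hq.two_le
  have hn1 : n + 1 = q ^ (2 * m) := by
    have : 0 < (q ^ 2) ^ m := by positivity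
    rw [hn, Nat.sub_add_cancel this, pow_mul]
  have hsq : n + 1 = q ^ m * q ^ m := by rw [hn1, two_mul, pow_add]
  have hrank : Module.finrank F C' = n := by
    rw [hC', finrank_matrixProductCode _ _
      (Matrix.linearIndependent_rows_iff_isUnit.2 (A.isUnit_iff_isUnit_det.2 hA.isUnit)),
      Fin.sum_univ_two]
    exact finrank_hermitianDual hq hF _
  -- Needed because `minDist` is 0 on the zero code.
  have hbot : C' ≠ ⊥ := by
    rintro rfl
    rw [finrank_bot] at hrank
    omega
  have hqq : 2 * q ≤ q ^ 2 := by
    rw [pow_two]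
    exact Nat.mul_le_mul_right _ hq2
  have hMq : q ^ 2 * q ≤ q ^ m := by
    rw [← pow_succ]
    exact Nat.pow_le_pow_right (by omega) hm
  have hMq' : q ^ 2 * 2 ≤ q ^ 2 * q := Nat.mul_le_mul_left _ hq2
  have hq4 : 2 ^ 2 ≤ q ^ 2 := Nat.pow_le_pow_left hq2 2
  have hMpos : 0 < q ^ m := Nat.pow_pos (by omega)
  refine ⟨hrank, fun hodd h0 h1 => ?_, fun heven => ?_⟩
  · have hM2 : q ^ (m + 2) = q ^ 2 * q ^ m := by rw [pow_add, mul_comm]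
    have main : ∀ t : ℕ, 2 ≤ t → t + 1 ≤ q ^ 2 → t * q ^ m ≤ δ → δ + 1 ≤ (t + 1) * q ^ m →
        δ - 1 + q ^ 2 ≤ q ^ (m + 2) →
        (2 * q ^ m - 2 * t + 2 : ℝ) ≤ minDist C' ∧ √(2 * n : ℝ) < 2 * q ^ m - 2 * t + 2 := by
      intro t ht ht' hδ1 hδ2 hδ3
      have htM : 2 * q ^ m ≤ t * q ^ m := Nat.mul_le_mul_right _ ht
      constructor
      · have h2 : min (2 * (q ^ m + 1 - t)) δ ≤ minDist C' := by
          refine le_minDist hbot fun x hx hx0 => ?_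
          rw [hC'] at hx
          refine min_le_hammingNorm hA h0 h1 (fun u hu hu0 => ?_)
            (fun v hv hv0 => le_hammingNorm_of_mem_bchCode hβ hv hv0) hx hx0
          have := le_hammingNorm_of_mem_hermitianDual hq hF hK hβ hm hodd hn1 (by omega)
            hδ2 hδ3 hu hu0
          omega
        have h3 : 2 * q ^ m + 2 ≤ minDist C' + 2 * t := by omega
        have h4 : (2 * q ^ m + 2 : ℝ) ≤ minDist C' + 2 * t := by exact_mod_cast h3
        linarith
      · refine sqrt_two_mul_lt hsq hMpos ?_
        have h5 : (40 * q ^ 2 : ℝ) ≤ 11 * q ^ m + 80 := by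
          exact_mod_cast forty_mul_sq_le hq2 hm
        have h6 : (t + 1 : ℝ) ≤ q ^ 2 := by exact_mod_cast ht'
        push_cast
        linarith
    -- Below the top block t = q² - 1, a spare q^m ≥ q² makes the last bound on δ automatic.
    have main' : ∀ t : ℕ, 2 ≤ t → t + 2 ≤ q ^ 2 → t * q ^ m ≤ δ → δ ≤ (t + 1) * q ^ m - 1 →
        (2 * q ^ m - 2 * t + 2 : ℝ) ≤ minDist C' ∧ √(2 * n : ℝ) < 2 * q ^ m - 2 * t + 2 := by
      intro t ht ht' hδ1 hδ2
      have h2 : (t + 1 + 1) * q ^ m ≤ q ^ 2 * q ^ m := Nat.mul_le_mul_right _ ht'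
      have h3 : (t + 1 + 1) * q ^ m = (t + 1) * q ^ m + q ^ m := by ring
      have h4 : 0 < (t + 1) * q ^ m := by positivity
      exact main t ht (by omega) hδ1 (by omega) (by omega)
    refine ⟨fun s hs hs' hδ1 hδ2 => main' s hs (by omega) hδ1 hδ2,
      fun a s ha ha' hs hδ1 hδ2 => ?_, fun s hs hδ1 hδ2 => ?_, fun hδ1 hδ2 => ?_⟩
    · have h2 : (a + 2) * q ≤ q * q := Nat.mul_le_mul_right _ (by omega)
      have h3 : 1 * q ≤ a * q := Nat.mul_le_mul_right _ ha
      have h4 : (a + 2) * q = a * q + 2 * q := by ring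
      rw [← pow_two] at h2
      have h := main' (a * q + s) (by omega) (by omega) hδ1 hδ2
      push_cast at h
      have e : (2 * q ^ m - 2 * a * q - 2 * s + 2 : ℝ) = 2 * q ^ m - 2 * (a * q + s) + 2 := by
        ring
      rwa [e]
    · have h := main' (q ^ 2 - q + s) (by omega) (by omega) hδ1 hδ2
      rw [Nat.cast_add, Nat.cast_sub (by omega), Nat.cast_pow] at h
      have e : (2 * q ^ m - 2 * q ^ 2 + 2 * q - 2 * s + 2 : ℝ) =
          2 * q ^ m - 2 * (q ^ 2 - q + s) + 2 := by
        ring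
      rwa [e]
    · have h2 : q ^ 2 * 1 ≤ q ^ 2 * q ^ m := Nat.mul_le_mul_left _ hMpos
      have h := main (q ^ 2 - 1) (by omega) (by omega) hδ1
        (by rw [Nat.sub_add_cancel (by omega)]; omega) (by omega)
      rw [Nat.cast_sub (by omega), Nat.cast_pow, Nat.cast_one] at h
      have e : (2 * q ^ m - 2 * q ^ 2 + 4 : ℝ) = 2 * q ^ m - 2 * (q ^ 2 - 1) + 2 := by
        ring
      rwa [e]
  · obtain ⟨r, rfl⟩ : ∃ r, m = r + 1 := ⟨m - 1, by omega⟩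
    simp only [Nat.add_sub_cancel]
    have hP : q ^ 2 ≤ q ^ r := Nat.pow_le_pow_right (by omega) (by omega)
    have hM : q ^ (r + 1) = q * q ^ r := by ring
    have hM2 : q ^ (r + 1 + 1) = q ^ 2 * q ^ r := by ring
    have hdist : δ - 1 + q ^ 2 ≤ q ^ 2 * q ^ r → δ ≤ minDist C' := by
      intro h
      rw [← hM2] at h
      refine le_minDist hbot fun x hx hx0 => ?_
      rw [hC'] at hx
      exact le_hammingNorm_of_le (hermitianDual_le_of_even hq hF hK hβ heven hn1 h)
        (fun v hv hv0 => le_hammingNorm_of_mem_bchCode hβ hv hv0) hx hx0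
    have hdist' : ∀ t : ℕ, t + 2 ≤ q ^ 2 → δ ≤ (t + 1) * q ^ r - 1 → δ ≤ minDist C' := by
      intro t ht hδ2
      have h2 : (t + 1 + 1) * q ^ r ≤ q ^ 2 * q ^ r := Nat.mul_le_mul_right _ ht
      have h3 : (t + 1 + 1) * q ^ r = (t + 1) * q ^ r + q ^ r := by ring
      exact hdist (by omega)
    -- Gives δ ≥ 1.5 q^m, above the 1.45 threshold.
    have hroot : ∀ t : ℕ, 3 * q ≤ 2 * t → t * q ^ r ≤ δ → √(2 * n : ℝ) < δ := by
      intro t ht hδ1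
      refine sqrt_two_mul_lt hsq hMpos ?_
      have h2 : 3 * q * q ^ r ≤ 2 * t * q ^ r := Nat.mul_le_mul_right _ ht
      have h3 : 3 * q ^ (r + 1) ≤ 2 * δ := by
        rw [hM]
        nlinarith
      have h4 : (3 * (q ^ (r + 1) : ℕ) : ℝ) ≤ 2 * δ := by exact_mod_cast h3
      have h5 : (0 : ℝ) ≤ (q ^ (r + 1) : ℕ) := Nat.cast_nonneg _
      linarith
    refine ⟨fun a s ha ha' hs _ hδ1 hδ2 => ?_, fun s hs hδ1 hδ2 => ?_, fun hδ1 hδ2 => ?_⟩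
    · have h2 : (a + 2) * q ≤ q * q := Nat.mul_le_mul_right _ (by omega)
      have h3 : 2 * q ≤ a * q := Nat.mul_le_mul_right _ ha
      have h4 : (a + 2) * q = a * q + 2 * q := by ring
      rw [← pow_two] at h2
      exact ⟨hdist' _ (by omega) hδ2, hroot _ (by omega) hδ1⟩
    -- For q = 2 one has t = 2, which violates 3q ≤ 2t; hence the exception.
    · refine ⟨hdist' _ (by omega) hδ2, fun hne => hroot _ ?_ hδ1⟩
      have h2 : 3 * q ≤ q * q := Nat.mul_le_mul_right _ (by omega)
      rw [← pow_two] at h2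
      omega
    · have h2 : q ^ 2 * 1 ≤ q ^ 2 * q ^ r := Nat.mul_le_mul_left _ (by omega)
      refine ⟨hdist (by omega), hroot _ ?_ hδ1⟩
      rcases Nat.lt_or_ge q 3 with h3 | h3
      · obtain rfl : q = 2 := by omega
        norm_num
      · have h4 : 3 * q ≤ q * q := Nat.mul_le_mul_right _ h3
        rw [← pow_two] at h4
        omega
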